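/- Let $K$ be a field and let $\Lambda$ and $\Gamma$ be finite-dimensional associative unital (not necessarily commutative) $K$-algebras. For a ring $A$, let $\operatorname{mod} A$ be the category of finitely generated left $A$-modules. For $A$ a finite-dimensional $K$-algebra and a positive integer $j$, a maximal $j$-orthogonal subcategory of $\operatorname{mod} A$ is a full subcategory $\mathscr{C}\subseteq\operatorname{mod} A$ such that: (a) $\mathscr{C}$ is functorially finite in $\operatorname{mod} A$: for every $D\in\operatorname{mod} A$ there are a morphism $D\to C$ with $C\in\mathscr{C}$ through which every morphism from $D$ to an object of $\mathscr{C}$ factors, and a morphism $C'\to D$ with $C'\in\mathscr{C}$ through which every morphism from an object of $\mathscr{C}$ to $D$ factors; (b) $\mathscr{C}=\{X\in\operatorname{mod} A \mid \operatorname{Ext}_A^i(X,C)=0 \text{ for all } C\in\mathscr{C},\ 1\le i\le j\}=\{X\in\operatorname{mod} A \mid \operatorname{Ext}_A^i(C,X)=0 \text{ for all } C\in\mathscr{C},\ 1\le i\le j\}$. Write $\mathbb{D}\Gamma^{op}=\operatorname{Hom}_K(\Gamma,K)$ for the $K$-dual of the right regular module $\Gamma_\Gamma$, a left $\Gamma$-module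 through $(\gamma f)(x)=f(x\gamma)$. **Proposition 5.1.** Suppose that the injective dimension $\operatorname{id}_\Lambda\Lambda$ of the left regular module is equal to an integer $n\ge 1$, and that $\operatorname{mod}(\Lambda\otimes_K\Gamma)$ has a maximal $j$-orthogonal subcategory for some $j\ge n$. Then $\operatorname{Hom}_\Gamma(\mathbb{D}\Gamma^{op},\Gamma)=0$. -/

import Mathlib

open CategoryTheory
open scoped TensorProduct

universe u

section RegularDual

variable (K : Type u) (Γ : Type u) [Field K] [Ring Γ] [Algebra K Γ]

/-- The underlying `K`-vector space `Hom_K(Γ, K)` of the `K`-dual of the right regular module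
`Γ_Γ`. It is a type synonym, so that its left `Γ`-module structure below cannot clash with the
structures that linear maps carry already. -/
def RegularDual : Type u := Γ →ₗ[K] K

noncomputable instance : AddCommGroup (RegularDual K Γ) :=
  inferInstanceAs (AddCommGroup (Γ →ₗ[K] K))

noncomputable instance : Module K (RegularDual K Γ) :=
  inferInstanceAs (Module K (Γ →ₗ[K] K))

/-- The left `Γ`-module structure on the dual of the right regular module:
`(γ • f) x = f (x * γ)`. -/
noncomputable instance : Module Γ (RegularDual K Γ) where
  smul γ f := LinearMap.comp (show Γ →ₗ[K] K from f) (LinearMap.mulRight K γ)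
  one_smul f := by
    refine LinearMap.ext fun x => ?_
    change (show Γ →ₗ[K] K from f) (x * 1) = (show Γ →ₗ[K] K from f) x
    rw [mul_one]
  mul_smul a b f := by
    refine LinearMap.ext fun x => ?_
    change (show Γ →ₗ[K] K from f) (x * (a * b)) = (show Γ →ₗ[K] K from f) (x * a * b)
    rw [mul_assoc]
  smul_zero a := rfl
  smul_add a f g := rfl
  add_smul a b f := by
    refine LinearMap.ext fun x => ?_
    change (show Γ →ₗ[K] K from f) (x * (a + b)) =
      (show Γ →ₗ[K] K from f) (x * a) + (show Γ →ₗ[K] K from f) (x * b)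
    rw [mul_add, map_add]
  zero_smul f := by
    refine LinearMap.ext fun x => ?_
    change (show Γ →ₗ[K] K from f) (x * 0) = 0
    rw [mul_zero, map_zero]

end RegularDual

section Orthogonal

variable {A : Type u} [Ring A]

/-- `f : D ⟶ C` is a left `𝒞`-approximation of `D`: `C` is in `𝒞`, and every morphism from `D`
to an object of `𝒞` factors through `f`. -/
def IsLeftApproximation (𝒞 : ObjectProperty (ModuleCat.{u} A)) {D C : ModuleCat.{u} A}
    (f : D ⟶ C) : Prop :=
  𝒞 C ∧ ∀ ⦃C' : ModuleCat.{u} A⦄, 𝒞 C' → ∀ g : D ⟶ C', ∃ h : C ⟶ C', f ≫ h = g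

/-- `f : C ⟶ D` is a right `𝒞`-approximation of `D`: `C` is in `𝒞`, and every morphism from an
object of `𝒞` to `D` factors through `f`. -/
def IsRightApproximation (𝒞 : ObjectProperty (ModuleCat.{u} A)) {C D : ModuleCat.{u} A}
    (f : C ⟶ D) : Prop :=
  𝒞 C ∧ ∀ ⦃C' : ModuleCat.{u} A⦄, 𝒞 C' → ∀ g : C' ⟶ D, ∃ h : C' ⟶ C, h ≫ f = g

/-- Every object of `𝒟` has a left `𝒞`-approximation. -/
def IsCovariantlyFinite (𝒞 𝒟 : ObjectProperty (ModuleCat.{u} A)) : Prop :=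
  ∀ ⦃D : ModuleCat.{u} A⦄, 𝒟 D → ∃ (C : ModuleCat.{u} A) (f : D ⟶ C), IsLeftApproximation 𝒞 f

/-- Every object of `𝒟` has a right `𝒞`-approximation. -/
def IsContravariantlyFinite (𝒞 𝒟 : ObjectProperty (ModuleCat.{u} A)) : Prop :=
  ∀ ⦃D : ModuleCat.{u} A⦄, 𝒟 D → ∃ (C : ModuleCat.{u} A) (f : C ⟶ D), IsRightApproximation 𝒞 f

/-- `𝒞` is functorially finite in `𝒟`. -/
def IsFunctoriallyFinite (𝒞 𝒟 : ObjectProperty (ModuleCat.{u} A)) : Prop :=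
  IsCovariantlyFinite 𝒞 𝒟 ∧ IsContravariantlyFinite 𝒞 𝒟

/-- The finitely generated modules `X` with `Ext^i(X, C) = 0` for all `C` in `𝒞` and
`1 ≤ i ≤ n`. -/
def leftOrthogonal (n : ℕ) (𝒞 : ObjectProperty (ModuleCat.{u} A)) :
    ObjectProperty (ModuleCat.{u} A) :=
  fun X => ModuleCat.isFG A X ∧ ∀ ⦃C : ModuleCat.{u} A⦄, 𝒞 C →
    ∀ i : ℕ, 1 ≤ i → i ≤ n → Subsingleton (Abelian.Ext.{u} X C i)

/-- The finitely generated modules `X` with `Ext^i(C, X) = 0` for all `C` in `𝒞` and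
`1 ≤ i ≤ n`. -/
def rightOrthogonal (n : ℕ) (𝒞 : ObjectProperty (ModuleCat.{u} A)) :
    ObjectProperty (ModuleCat.{u} A) :=
  fun X => ModuleCat.isFG A X ∧ ∀ ⦃C : ModuleCat.{u} A⦄, 𝒞 C →
    ∀ i : ℕ, 1 ≤ i → i ≤ n → Subsingleton (Abelian.Ext.{u} C X i)

/-- `𝒞` is a maximal `n`-orthogonal subcategory of `𝒟`, for full subcategories `𝒞 ⊆ 𝒟` of the
category of finitely generated left `A`-modules. -/
structure IsMaximalOrthogonal (n : ℕ) (𝒞 𝒟 : ObjectProperty (ModuleCat.{u} A)) : Prop where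
  le : 𝒞 ≤ 𝒟
  le_isFG : 𝒟 ≤ ModuleCat.isFG A
  functoriallyFinite : IsFunctoriallyFinite 𝒞 𝒟
  eq_left : 𝒞 = leftOrthogonal n 𝒞 ⊓ 𝒟
  eq_right : 𝒞 = rightOrthogonal n 𝒞 ⊓ 𝒟

end Orthogonal

/-! Write D for the `K`-dual and suppose some f : DΓ → Γ is nonzero. A maximal j-orthogonal
subcategory contains every finitely generated projective and injective, hence both Λ ⊗ Γ and the
coextension Hom_Λ(Λ ⊗ Γ, DΛ). Since 1 ≤ n ≤ j, Ext^n from the latter to the former vanishes.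

Coextension M ↦ Hom_Λ(Λ ⊗ Γ, M) ≃ M ⊗ DΓ is exact. Choose x with f x ≠ 0 and a functional φ with φ
(f x) = 1. The composite Λ → Λ ⊗ DΓ → Λ ⊗ Γ → Λ given by x, f and φ is the identity, so a class in
Ext^n_Λ(M, Λ) is recovered from its coextension pushed forward along f
(`TensorAlgebra.subsingleton_ext_of_coextend`). With M = DΛ this gives Ext^n_Λ(DΛ, Λ) = 0.

Each Λ/I embeds in a finite power of DΛ, and Ext^n(-, Λ) turns monomorphisms into epimorphisms
because id Λ ≤ n. Hence Ext^n(Λ/I, Λ) = 0 for all left ideals I, and Baer's criterion yields id Λ <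
n, a contradiction (`hasInjectiveDimensionLT_of_subsingleton_ext_regularDual`). -/

/-! ### Ext groups under exact functors, retracts and monomorphisms. -/

namespace CategoryTheory.Abelian.Ext

universe w w' v v' u₁ u₂

variable {C : Type u₁} [Category.{v} C] [Abelian C] [HasExt.{w} C]
variable {D : Type u₂} [Category.{v'} D] [Abelian D] [HasExt.{w'} D]

open Limits

/-- The map induced on `Ext` by the composite of two exact functors is compatible with natural
transformations from the identity functor. -/
theorem mapExactFunctor_naturality [EnoughProjectives C]
    (F : C ⥤ D) [F.Additive] [PreservesFiniteLimits F] [PreservesFiniteColimits F]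
    (G : D ⥤ C) [G.Additive] [PreservesFiniteLimits G] [PreservesFiniteColimits G]
    (η : 𝟭 C ⟶ F ⋙ G) {X Y : C} {n : ℕ} (e : Ext.{w} X Y n) :
    (mk₀ (η.app X)).comp ((e.mapExactFunctor F).mapExactFunctor G) (zero_add n) =
      e.comp (mk₀ (η.app Y)) (add_zero n) := by
  induction n generalizing X with
  | zero =>
    obtain ⟨f, rfl⟩ := homEquiv₀.symm.surjective e
    have := η.naturality f
    simp only [Functor.id_obj, Functor.id_map, Functor.comp_map] at this
    simp [homEquiv₀_symm_apply, mapExactFunctor_mk₀, this]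
  | succ n ih =>
    let P : ProjectivePresentation X := Classical.arbitrary _
    let S := ShortComplex.mk _ _ (kernel.condition P.f)
    have hS : S.ShortExact := { exact := ShortComplex.exact_kernel P.f }
    have : Projective S.X₂ := P.projective
    -- Dimension shift: as the middle term is projective, a class of degree n + 1 is the extension
    -- class times a class of degree n.
    obtain ⟨e, rfl⟩ := contravariant_sequence_exact₃ hS Y e (eq_zero_of_projective _)
      (add_comm 1 n)
    have hmap : (hS.extClass.mapExactFunctor F).mapExactFunctor G =
        ((hS.map_of_exact F).map_of_exact G).extClass :=
      (congrArg (mapExactFunctor G) (mapExactFunctor_extClass F hS)).trans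
        (mapExactFunctor_extClass G (hS.map_of_exact F))
    -- η is a morphism from the short exact sequence to its image under `F ⋙ G`, and extension
    -- classes are natural in such morphisms.
    have key : hS.extClass.comp (mk₀ (η.app S.X₁)) (add_zero 1) =
        (mk₀ (η.app S.X₃)).comp ((hS.extClass.mapExactFunctor F).mapExactFunctor G)
          (zero_add 1) :=
      (ShortComplex.ShortExact.extClass_naturality hS ((hS.map_of_exact F).map_of_exact G)
        (S.mapNatTrans η)).trans
        (congrArg (fun t => (mk₀ (η.app S.X₃)).comp t (zero_add 1)) hmap.symm)
    rw [mapExactFunctor_comp, mapExactFunctor_comp,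
      ← comp_assoc (mk₀ (η.app S.X₃)) ((hS.extClass.mapExactFunctor F).mapExactFunctor G)
        ((e.mapExactFunctor F).mapExactFunctor G) (zero_add 1) (add_comm 1 n) (by lia), ← key,
      comp_assoc hS.extClass (mk₀ (η.app S.X₁)) ((e.mapExactFunctor F).mapExactFunctor G)
        (add_zero 1) (zero_add n) (by lia), ih,
      comp_assoc hS.extClass e (mk₀ (η.app Y)) (add_comm 1 n) (add_zero n) (by lia)]

/-- If the identity of `X` is a finite sum of maps factoring through `M`, then `Ext(X, Y)` vanishes
whenever `Ext(M, Y)` does. -/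
theorem subsingleton_of_sum_eq_id {X M Y : C} {n : ℕ} {ι : Type*} [Fintype ι]
    (p : ι → (X ⟶ M)) (q : ι → (M ⟶ X)) (h : ∑ i, p i ≫ q i = 𝟙 X)
    (hM : Subsingleton (Ext.{w} M Y n)) : Subsingleton (Ext.{w} X Y n) := by
  refine subsingleton_of_forall_eq 0 fun e => ?_
  rw [← mk₀_id_comp e, ← h, mk₀_sum, sum_comp]
  refine Finset.sum_eq_zero fun i _ => ?_
  rw [← mk₀_comp_mk₀, comp_assoc (mk₀ (p i)) (mk₀ (q i)) e (zero_add 0) (zero_add n) (by lia),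
    Subsingleton.elim ((mk₀ (q i)).comp e (zero_add n)) 0, comp_zero]

/-- If `Y` has injective dimension at most `n` then `Ext^n(-, Y)` turns monomorphisms into
epimorphisms. -/
theorem subsingleton_of_mono {X M Y : C} {n : ℕ} (f : X ⟶ M) [Mono f]
    [HasInjectiveDimensionLT Y (n + 1)]
    (hM : Subsingleton (Ext.{w} M Y n)) : Subsingleton (Ext.{w} X Y n) := by
  refine subsingleton_of_forall_eq 0 fun e => ?_
  have hS : (ShortComplex.mk _ _ (cokernel.condition f)).ShortExact :=
    { exact := ShortComplex.exact_cokernel f }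
  obtain ⟨e', rfl⟩ := contravariant_sequence_exact₁ hS Y e (add_comm 1 n)
    (eq_zero_of_hasInjectiveDimensionLT _ (n + 1) le_rfl)
  rw [Subsingleton.elim e' 0, comp_zero]

end CategoryTheory.Abelian.Ext

/-! ### Injective dimension tested on cyclic modules. -/

open Abelian in
/-- **Baer's criterion** for injective dimension. -/
theorem ModuleCat.hasInjectiveDimensionLT_of_subsingleton_ext_quotient {R : Type u} [Ring R]
    (n : ℕ) (N : ModuleCat.{u} R)
    (h : ∀ I : Ideal R, Subsingleton (Ext.{u} (ModuleCat.of R (R ⧸ I)) N (n + 1))) :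
    HasInjectiveDimensionLT N (n + 1) := by
  induction n generalizing N with
  | zero =>
    rw [zero_add, ← injective_iff_hasInjectiveDimensionLT_one,
      ← Module.injective_iff_injective_object, ← Module.Baer.iff_injective]
    intro I g
    let S := ShortComplex.moduleCatMk I.subtype I.mkQ (by ext x; simp)
    have hS : S.ShortExact :=
      ModuleCat.shortComplex_shortExact _ (LinearMap.exact_subtype_mkQ I)
        I.injective_subtype I.mkQ_surjective
    obtain ⟨e, he⟩ := Ext.contravariant_sequence_exact₁ hS N (Ext.mk₀ (ModuleCat.ofHom g))
      (add_zero 1) ((h I).elim _ _)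
    obtain ⟨e, rfl⟩ := Ext.homEquiv₀.symm.surjective e
    rw [Ext.homEquiv₀_symm_apply, Ext.mk₀_comp_mk₀] at he
    have he := Ext.homEquiv₀.symm.injective he
    refine ⟨e.hom, fun x hx => ?_⟩
    exact congrArg (fun t => t.hom ⟨x, hx⟩) he
  | succ n ih =>
    have hS : (ShortComplex.mk _ _ (Limits.cokernel.condition (Injective.ι N))).ShortExact :=
      { exact := ShortComplex.exact_cokernel (Injective.ι N) }
    -- Dimension shift along N → J → J/N with J injective: Ext^(n+1)(R/I, J/N) sits between
    -- Ext^(n+1)(R/I, J) = 0 and Ext^(n+2)(R/I, N) = 0.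
    refine (hS.hasInjectiveDimensionLT_X₃_iff n inferInstance).mp (ih _ fun I => ?_)
    refine subsingleton_of_forall_eq 0 fun e => ?_
    obtain ⟨e', rfl⟩ := Ext.covariant_sequence_exact₃ _ hS e rfl ((h I).elim _ _)
    rw [Ext.eq_zero_of_injective e', Ext.zero_comp]

/-! ### The dual of the regular module as an injective cogenerator. -/

section RegularDual

variable (K : Type u) (Γ : Type u) [Field K] [Ring Γ] [Algebra K Γ]

namespace RegularDual

instance : IsScalarTower K Γ (RegularDual K Γ) where
  smul_assoc c γ f := LinearMap.ext fun x =>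
    (congrArg f.toFun (mul_smul_comm c x γ)).trans (LinearMap.map_smul f c (x * γ))

instance [FiniteDimensional K Γ] : Module.Finite Γ (RegularDual K Γ) :=
  have : Module.Finite K (RegularDual K Γ) := inferInstanceAs (Module.Finite K (Γ →ₗ[K] K))
  Module.Finite.of_restrictScalars_finite K Γ _

variable {K Γ}

/-- A `K`-linear functional on a `Γ`-module is the same as a `Γ`-linear map to the dual of the
regular module. -/
def ofFunctional {M : Type*} [AddCommGroup M] [Module K M] [Module Γ M] [IsScalarTower K Γ M]
    (φ : M →ₗ[K] K) : M →ₗ[Γ] RegularDual K Γ where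
  toFun m := φ ∘ₗ (LinearMap.toSpanSingleton Γ M m).restrictScalars K
  map_add' m m' := LinearMap.ext fun x => by simp; rfl
  map_smul' γ m := LinearMap.ext fun x => (congrArg φ (mul_smul x γ m)).symm

theorem ofFunctional_apply_one {M : Type*} [AddCommGroup M] [Module K M] [Module Γ M]
    [IsScalarTower K Γ M] (φ : M →ₗ[K] K) (m : M) :
    (show Γ →ₗ[K] K from ofFunctional φ m) 1 = φ m :=
  congrArg φ (one_smul Γ m)

variable (K Γ)

/-- By Baer's criterion: a map from a left ideal is determined by its composite with evaluation at
1, and that `K`-linear functional extends to all of Γ because `K` is a field. -/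
theorem injective : Module.Injective Γ (RegularDual K Γ) := by
  refine Module.Baer.injective fun I g => ?_
  let ev : RegularDual K Γ →ₗ[K] K := LinearMap.applyₗ (R := K) (1 : Γ)
  obtain ⟨φ, hφ⟩ := LinearMap.exists_extend (p := I.restrictScalars K)
    (ev ∘ₗ g.restrictScalars K)
  refine ⟨ofFunctional φ, fun x hx => LinearMap.ext fun y => ?_⟩
  have h := LinearMap.congr_fun hφ ⟨y * x, I.mul_mem_left y hx⟩
  refine h.trans ?_
  have h' : g (y • ⟨x, hx⟩) = y • g ⟨x, hx⟩ := map_smul g _ _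
  have h'' := congrArg ev h'
  refine h''.trans (congrArg (show Γ →ₗ[K] K from g ⟨x, hx⟩) (one_mul y))

end RegularDual

end RegularDual

open Abelian in
/-- For a module `N` of injective dimension at most `n ≥ 1`, the group `Ext^n(DΛ, N)` detects
whether the dimension is smaller than `n`. -/
theorem hasInjectiveDimensionLT_of_subsingleton_ext_regularDual (K Λ : Type u) [Field K] [Ring Λ]
    [Algebra K Λ] [FiniteDimensional K Λ] (n : ℕ) (N : ModuleCat.{u} Λ)
    [HasInjectiveDimensionLT N (n + 2)]
    (h : Subsingleton (Ext.{u} (ModuleCat.of Λ (RegularDual K Λ)) N (n + 1))) :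
    HasInjectiveDimensionLT N (n + 1) := by
  refine ModuleCat.hasInjectiveDimensionLT_of_subsingleton_ext_quotient n N fun I => ?_
  let b := Module.finBasis K (Λ ⧸ I)
  let φ : (Λ ⧸ I) →ₗ[Λ] (Fin (Module.finrank K (Λ ⧸ I)) → RegularDual K Λ) :=
    LinearMap.pi fun i => RegularDual.ofFunctional (b.coord i)
  -- Evaluating the i-th component at 1 returns the i-th coordinate, so the kernel is zero.
  have : Mono (ModuleCat.ofHom φ) := by
    rw [ModuleCat.mono_iff_injective]
    refine (injective_iff_map_eq_zero φ).mpr fun q hq => b.forall_coord_eq_zero_iff.mp fun i => ?_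
    rw [← RegularDual.ofFunctional_apply_one (Γ := Λ)]
    exact congrArg (fun t => (show Λ →ₗ[K] K from t i) 1) hq
  refine Ext.subsingleton_of_mono (ModuleCat.ofHom φ) ?_
  refine Ext.subsingleton_of_sum_eq_id (fun i => ModuleCat.ofHom (LinearMap.proj i))
    (fun i => ModuleCat.ofHom (LinearMap.single Λ (fun _ => RegularDual K Λ) i)) ?_ h
  ext v
  simp [ModuleCat.hom_sum]

/-! ### Exactness of restriction and coextension of scalars. -/

namespace ModuleCat

open Limits

/-- Coextension of scalars along a ring homomorphism `R → S` with `S` projective over `R` preserves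
epimorphisms. -/
theorem coextendScalars_map_epi {R S : Type u} [Ring R] [Ring S] (ι : R →+* S)
    [Module.Projective R ((restrictScalars ι).obj (of S S))] {M N : ModuleCat.{u} R} (g : M ⟶ N)
    [Epi g] : Epi ((coextendScalars ι).map g) := by
  rw [ModuleCat.epi_iff_surjective]
  intro h
  obtain ⟨h', hh'⟩ := Module.projective_lifting_property g.hom (CoextendScalars.equiv ι N h)
    ((ModuleCat.epi_iff_surjective g).mp inferInstance)
  exact ⟨(CoextendScalars.equiv ι M).symm h', CoextendScalars.ext hh'⟩

instance coextendScalars_additive {R S : Type u} [Ring R] [Ring S] (ι : R →+* S) :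
    (coextendScalars.{u, u, u} ι).Additive :=
  (restrictCoextendScalarsAdj.{u} ι).right_adjoint_additive

instance coextendScalars_preservesFiniteLimits {R S : Type u} [Ring R] [Ring S] (ι : R →+* S) :
    PreservesFiniteLimits (coextendScalars.{u, u, u} ι) :=
  have := (restrictCoextendScalarsAdj.{u} ι).rightAdjoint_preservesLimits
  inferInstance

/-- Left exactness is automatic for a right adjoint; projectivity of `S` over `R` supplies the
missing surjectivity. -/
theorem coextendScalars_preservesFiniteColimits {R S : Type u} [Ring R] [Ring S] (ι : R →+* S)
    [Module.Projective R ((restrictScalars ι).obj (of S S))] :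
    PreservesFiniteColimits (coextendScalars.{u, u, u} ι) := by
  refine ((coextendScalars.{u, u, u} ι).preservesFiniteColimits_tfae.out 0 3).mp fun T hT => ?_
  have := hT.epi_g
  have := hT.mono_f
  have hlim : PreservesFiniteLimits (coextendScalars.{u, u, u} ι) := inferInstance
  exact ⟨((((coextendScalars.{u, u, u} ι).preservesFiniteLimits_tfae.out 3 0 :)).mp hlim T hT).1,
    coextendScalars_map_epi ι T.g⟩

theorem restrictScalars_map_exact_of_exact {R S : Type u} [Ring R] [Ring S] (ι : R →+* S)
    (T : ShortComplex (ModuleCat.{u} S)) (h : T.Exact) :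
    (T.map (restrictScalars.{u} ι)).Exact := by
  rw [ShortComplex.ShortExact.moduleCat_exact_iff_function_exact] at h ⊢
  exact h

theorem restrictScalars_exact {R S : Type u} [Ring R] [Ring S] (ι : R →+* S) :
    PreservesFiniteLimits (restrictScalars.{u} ι) ∧
      PreservesFiniteColimits (restrictScalars.{u} ι) :=
  ((Functor.exact_tfae (restrictScalars.{u} ι)).out 1 3).mp
    (restrictScalars_map_exact_of_exact ι)

theorem finite_of_restrictScalars {R S : Type u} [Ring R] [Ring S] (ι : R →+* S)
    (M : ModuleCat.{u} S) (h : Module.Finite R ((restrictScalars ι).obj M)) :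
    Module.Finite S M := by
  obtain ⟨s, hs⟩ := h.fg_top
  let t : Finset M := s
  refine ⟨⟨t, eq_top_iff.mpr fun m _ => ?_⟩⟩
  -- The `S`-span of the `R`-generators, viewed as an `R`-submodule.
  let N : Submodule R ((restrictScalars ι).obj M) :=
    { carrier := (Submodule.span S (t : Set M) : Set M)
      add_mem' := Submodule.add_mem (Submodule.span S (t : Set M))
      zero_mem' := Submodule.zero_mem (Submodule.span S (t : Set M))
      smul_mem' r _ h := Submodule.smul_mem (Submodule.span S (t : Set M)) (ι r) h }
  have hN : Submodule.span R (s : Set ((restrictScalars ι).obj M)) ≤ N :=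
    Submodule.span_le.mpr fun y hy => Submodule.subset_span (R := S) (M := M) hy
  rw [hs] at hN
  exact hN (show (show (restrictScalars ι).obj M from m) ∈ (⊤ : Submodule R _) from trivial)

end ModuleCat

/-! ### Coextension from Λ to Λ ⊗ Γ, in coordinates. -/

namespace TensorAlgebra

open ModuleCat

variable (K Λ Γ : Type u) [Field K] [Ring Λ] [Algebra K Λ] [Ring Γ] [Algebra K Γ]

/-- The inclusion `λ ↦ λ ⊗ 1`. -/
abbrev incl : Λ →+* Λ ⊗[K] Γ := Algebra.TensorProduct.includeLeftRingHom

theorem incl_mul (l : Λ) (a : Λ ⊗[K] Γ) : incl K Λ Γ l * a = l • a := by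
  have : incl K Λ Γ l = l • (1 : Λ ⊗[K] Γ) := by
    simp [TensorProduct.smul_tmul', Algebra.TensorProduct.one_def]
  rw [this, smul_mul_assoc, one_mul]

/-- The `Λ`-module structure of `Λ ⊗ Γ` on the left factor is restriction of scalars. -/
noncomputable def restrictEquiv :
    (Λ ⊗[K] Γ) ≃ₗ[Λ] (restrictScalars (incl K Λ Γ)).obj (of (Λ ⊗[K] Γ) (Λ ⊗[K] Γ)) where
  __ := AddEquiv.refl _
  map_smul' l a := (incl_mul K Λ Γ l a).symm

/-- Freeness over Λ is what makes coextension exact. -/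
instance : Module.Free Λ ((restrictScalars (incl K Λ Γ)).obj (of (Λ ⊗[K] Γ) (Λ ⊗[K] Γ))) :=
  Module.Free.of_equiv (restrictEquiv K Λ Γ)

/-- Coextension of scalars from `Λ` to `Λ ⊗ Γ`. -/
noncomputable abbrev coextend : ModuleCat.{u} Λ ⥤ ModuleCat.{u} (Λ ⊗[K] Γ) :=
  coextendScalars.{u, u, u} (incl K Λ Γ)

/-- Restriction of scalars from `Λ ⊗ Γ` to `Λ`. -/
noncomputable abbrev restrict : ModuleCat.{u} (Λ ⊗[K] Γ) ⥤ ModuleCat.{u} Λ :=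
  restrictScalars.{u} (incl K Λ Γ)

instance : Limits.PreservesFiniteColimits (coextend K Λ Γ) :=
  coextendScalars_preservesFiniteColimits _

instance : Limits.PreservesFiniteLimits (restrict K Λ Γ) :=
  (restrictScalars_exact _).1

instance : Limits.PreservesFiniteColimits (restrict K Λ Γ) :=
  (restrictScalars_exact _).2

variable {K Λ Γ}

/-- An element of a coextended module as a `Λ`-linear map on `Λ ⊗ Γ`. -/
noncomputable def evalMap {M : ModuleCat.{u} Λ} (h : (coextend K Λ Γ).obj M) :
    (Λ ⊗[K] Γ) →ₗ[Λ] M :=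
  (CoextendScalars.equiv (incl K Λ Γ) M h) ∘ₗ (restrictEquiv K Λ Γ).toLinearMap

theorem evalMap_smul {M : ModuleCat.{u} Λ} (a b : Λ ⊗[K] Γ) (h : (coextend K Λ Γ).obj M) :
    evalMap (a • h) b = evalMap h (b * a) := rfl

theorem evalMap_injective {M : ModuleCat.{u} Λ} :
    Function.Injective (evalMap (K := K) (Γ := Γ) (M := M)) := fun _ _ e =>
  CoextendScalars.ext (LinearMap.ext fun a => LinearMap.congr_fun e a)

theorem evalMap_tmul {M : ModuleCat.{u} Λ} (h : (coextend K Λ Γ).obj M) (l : Λ) (g : Γ) :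
    evalMap h (l ⊗ₜ g) = l • evalMap h (1 ⊗ₜ g) := by
  rw [← map_smul, TensorProduct.smul_tmul', smul_eq_mul, mul_one]

/-- Slicing `Λ ⊗ Γ` by a functional on `Γ`. -/
noncomputable def slice (x : Γ →ₗ[K] K) : (Λ ⊗[K] Γ) →ₗ[Λ] Λ :=
  (TensorProduct.AlgebraTensorModule.rid K Λ Λ).toLinearMap ∘ₗ
    TensorProduct.AlgebraTensorModule.map LinearMap.id x

theorem slice_tmul (x : Γ →ₗ[K] K) (l : Λ) (g : Γ) : slice x (l ⊗ₜ[K] g) = x g • l := by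
  simp [slice]

/-- Slicing respects right as well as left multiplication by Λ; the right-hand version is what makes
m ↦ (a ↦ `slice x a` • m) linear over Λ. -/
theorem slice_mul_incl (x : Γ →ₗ[K] K) (a : Λ ⊗[K] Γ) (l : Λ) :
    slice x (a * incl K Λ Γ l) = slice x a * l := by
  induction a with
  | zero => simp
  | add a b ha hb => simp only [add_mul, map_add, ha, hb]
  | tmul l' g => simp [slice_tmul]

/-- The natural map `M → Hom_Λ(Λ ⊗ Γ, M)` given by a functional on `Γ`. -/
noncomputable def unit (x : Γ →ₗ[K] K) :
    𝟭 (ModuleCat.{u} Λ) ⟶ coextend K Λ Γ ⋙ restrict K Λ Γ where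
  app M := ofHom (Y := (restrict K Λ Γ).obj ((coextend K Λ Γ).obj M))
    { toFun m := (CoextendScalars.equiv (incl K Λ Γ) M).symm
        ((LinearMap.toSpanSingleton Λ M m ∘ₗ slice x) ∘ₗ (restrictEquiv K Λ Γ).symm.toLinearMap)
      map_add' m m' := evalMap_injective <| LinearMap.ext fun a => smul_add (slice x a) m m'
      map_smul' l m := evalMap_injective <| LinearMap.ext fun a => by
        refine (mul_smul (slice x a) l m).symm.trans ?_
        exact congrArg (· • m) (slice_mul_incl x a l).symm }
  naturality M N g := by
    ext m
    exact evalMap_injective <| LinearMap.ext fun a => (map_smul g.hom (slice x a) m).symm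

variable [FiniteDimensional K Γ]

/-- A Λ-linear map on Λ ⊗ Γ is determined by its values on the elements 1 ⊗ b i, so the coextension
embeds over Λ in a finite power of the noetherian module `M`. -/
theorem isFG_coextend [IsNoetherianRing Λ] (M : ModuleCat.{u} Λ) [Module.Finite Λ M] :
    ModuleCat.isFG _ ((coextend K Λ Γ).obj M) := by
  let b := Module.finBasis K Γ
  let N := (restrict K Λ Γ).obj ((coextend K Λ Γ).obj M)
  let ev : N →ₗ[Λ] (Fin (Module.finrank K Γ) → M) :=
    { toFun h i := evalMap (K := K) (Γ := Γ) (M := M) h (1 ⊗ₜ b i)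
      map_add' h h' := rfl
      map_smul' l h := funext fun i => by
        refine (evalMap_smul (M := M) (incl K Λ Γ l) (1 ⊗ₜ b i) h).trans ?_
        refine Eq.trans ?_ (evalMap_tmul (M := M) h l (b i))
        simp }
  have hev : Function.Injective ev := fun h h' e => by
    refine evalMap_injective (K := K) (Γ := Γ) (M := M)
      ((Algebra.TensorProduct.basis Λ b).ext fun i => ?_)
    rw [Algebra.TensorProduct.basis_apply]
    exact congrFun e i
  have hN : Module.Finite Λ N := Module.Finite.of_injective ev hev
  exact finite_of_restrictScalars _ _ hN

/-- The coordinate functionals of a basis of `Γ` as elements of the dual. -/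
noncomputable def dualVec (i : Fin (Module.finrank K Γ)) : RegularDual K Γ :=
  (Module.finBasis K Γ).coord i

theorem sum_apply_smul_dualVec (x : RegularDual K Γ) :
    ∑ i, (show Γ →ₗ[K] K from x) (Module.finBasis K Γ i) • dualVec i = x :=
  (Module.finBasis K Γ).sum_dual_apply_smul_coord x

/-- The coordinates of an element of `Hom_Λ(Λ ⊗ Γ, Λ)`. -/
noncomputable def coeff (h : (coextend K Λ Γ).obj (of Λ Λ))
    (i : Fin (Module.finrank K Γ)) : Λ :=
  evalMap h (1 ⊗ₜ Module.finBasis K Γ i)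

theorem coeff_add (h h' : (coextend K Λ Γ).obj (of Λ Λ)) (i : Fin (Module.finrank K Γ)) :
    coeff (h + h') i = coeff h i + coeff h' i := rfl

theorem coeff_zero (i : Fin (Module.finrank K Γ)) :
    coeff (0 : (coextend K Λ Γ).obj (of Λ Λ)) i = 0 := rfl

/-- Acting on `h` multiplies its argument on the right, and (1 ⊗ b i)(l ⊗ g) = l ⊗ (b i * g); the
scalars are the matrix of right multiplication by g. -/
theorem coeff_tmul_smul (l : Λ) (g : Γ) (h : (coextend K Λ Γ).obj (of Λ Λ))
    (i : Fin (Module.finrank K Γ)) :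
    coeff ((l ⊗ₜ[K] g) • h) i =
      ∑ k, (Module.finBasis K Γ).coord k (Module.finBasis K Γ i * g) • (l * coeff h k) := by
  have h1 : coeff ((l ⊗ₜ[K] g) • h) i =
      evalMap h ((1 : Λ) ⊗ₜ Module.finBasis K Γ i * l ⊗ₜ g) := rfl
  have h2 (k) (c : K) : evalMap h (l ⊗ₜ[K] (c • Module.finBasis K Γ k)) = c • (l * coeff h k) := by
    rw [TensorProduct.tmul_smul, TensorProduct.smul_tmul', evalMap_tmul]
    exact smul_mul_assoc c l (coeff h k)
  rw [h1, Algebra.TensorProduct.tmul_mul_tmul, one_mul]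
  conv_lhs => rw [← (Module.finBasis K Γ).sum_repr (_ * g), TensorProduct.tmul_sum]
  exact (map_sum (evalMap h) _ _).trans (Finset.sum_congr rfl fun k _ => h2 k _)

theorem coeff_unit (x : Γ →ₗ[K] K) (l : Λ) (i : Fin (Module.finrank K Γ)) :
    coeff ((unit x).app (of Λ Λ) l) i = x (Module.finBasis K Γ i) • l := by
  refine (congrArg (· * l) (slice_tmul x (1 : Λ) (Module.finBasis K Γ i))).trans ?_
  rw [smul_mul_assoc, one_mul]

variable (f : RegularDual K Γ →ₗ[Γ] Γ)

/-- The left side is f applied to the expansion of g • `dualVec k` in the dual basis. Its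
coefficients are the matrix entries of `coeff_tmul_smul`, which is why `contract` is linear. -/
theorem sum_coord_smul_map_dualVec (g : Γ) (k : Fin (Module.finrank K Γ)) :
    ∑ i, (Module.finBasis K Γ).coord k (Module.finBasis K Γ i * g) • f (dualVec i) =
      g * f (dualVec k) := by
  rw [← smul_eq_mul, ← map_smul f, ← sum_apply_smul_dualVec (g • dualVec k), map_sum]
  exact Finset.sum_congr rfl fun i _ => (LinearMap.map_smul_of_tower f _ _).symm

/-- The `Λ ⊗ Γ`-linear map `Hom_Λ(Λ ⊗ Γ, Λ) ≃ Λ ⊗ DΓ → Λ ⊗ Γ` induced by `f : DΓ → Γ`. -/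
noncomputable def contract :
    (coextend K Λ Γ).obj (of Λ Λ) →ₗ[Λ ⊗[K] Γ] Λ ⊗[K] Γ where
  toFun h := ∑ i, coeff h i ⊗ₜ[K] f (dualVec i)
  map_add' h h' := by
    simp only [coeff_add, TensorProduct.add_tmul, Finset.sum_add_distrib]
  map_smul' a h := by
    rw [RingHom.id_apply]
    induction a with
    | zero => simp only [zero_smul, coeff_zero, TensorProduct.zero_tmul, Finset.sum_const_zero]
    | add a a' ha ha' =>
      simp only [add_smul, coeff_add, TensorProduct.add_tmul, Finset.sum_add_distrib, ha, ha']
    | tmul l g =>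
      simp only [coeff_tmul_smul, smul_eq_mul, Finset.mul_sum,
        Algebra.TensorProduct.tmul_mul_tmul, TensorProduct.sum_tmul, TensorProduct.smul_tmul,
        ← sum_coord_smul_map_dualVec, TensorProduct.tmul_sum]
      -- Both sides are now one double sum over pairs of basis indices.
      exact Finset.sum_comm

/-- Under Hom_Λ(Λ ⊗ Γ, Λ) ≃ Λ ⊗ DΓ, the map `unit x` is l ↦ l ⊗ x and `contract f` is id ⊗ f. -/
theorem contract_unit (x : RegularDual K Γ) (l : Λ) :
    contract f ((unit (Λ := Λ) (show Γ →ₗ[K] K from x)).app (of Λ Λ) l) = l ⊗ₜ[K] f x := by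
  conv_rhs => rw [← sum_apply_smul_dualVec x, map_sum, TensorProduct.tmul_sum]
  change ∑ i, coeff _ i ⊗ₜ[K] f (dualVec i) = _
  refine Finset.sum_congr rfl fun i _ => ?_
  rw [LinearMap.map_smul_of_tower, ← TensorProduct.smul_tmul]
  exact congrArg (· ⊗ₜ[K] f (dualVec i)) (coeff_unit _ l i)

end TensorAlgebra

/-! ### Projectives and injectives in maximal orthogonal subcategories. -/

section Orthogonal

open Abelian

variable {A : Type u} [Ring A] {j : ℕ} {𝒞 : ObjectProperty (ModuleCat.{u} A)}

theorem IsMaximalOrthogonal.of_projective (h : IsMaximalOrthogonal j 𝒞 (ModuleCat.isFG A))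
    (P : ModuleCat.{u} A) [Projective P] (hP : ModuleCat.isFG A P) : 𝒞 P := by
  rw [h.eq_left]
  refine ⟨⟨hP, fun C _ i hi _ => subsingleton_of_forall_eq 0 fun e => ?_⟩, hP⟩
  obtain ⟨i, rfl⟩ := Nat.exists_eq_add_of_le' hi
  exact e.eq_zero_of_projective

theorem IsMaximalOrthogonal.of_injective (h : IsMaximalOrthogonal j 𝒞 (ModuleCat.isFG A))
    (J : ModuleCat.{u} A) [Injective J] (hJ : ModuleCat.isFG A J) : 𝒞 J := by
  rw [h.eq_right]
  refine ⟨⟨hJ, fun C _ i hi _ => subsingleton_of_forall_eq 0 fun e => ?_⟩, hJ⟩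
  obtain ⟨i, rfl⟩ := Nat.exists_eq_add_of_le' hi
  exact e.eq_zero_of_injective

theorem IsMaximalOrthogonal.subsingleton_ext (h : IsMaximalOrthogonal j 𝒞 (ModuleCat.isFG A))
    {X Y : ModuleCat.{u} A} (hX : 𝒞 X) (hY : 𝒞 Y) {i : ℕ} (hi : 1 ≤ i) (hij : i ≤ j) :
    Subsingleton (Ext.{u} X Y i) := by
  rw [h.eq_left] at hX
  exact hX.1.2 hY i hi hij

end Orthogonal

/-! ### Transfer of Ext vanishing to Λ, and the conclusion. -/

open Abelian TensorAlgebra in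
/-- If some `Γ`-linear map `DΓ → Γ` is nonzero, then `Ext^n_Λ(M, Λ)` vanishes as soon as the
group `Ext^n` over `Λ ⊗ Γ` from the coextension of `M` to the regular module does. -/
theorem TensorAlgebra.subsingleton_ext_of_coextend {K Λ Γ : Type u} [Field K]
    [Ring Λ] [Algebra K Λ] [Ring Γ] [Algebra K Γ] [FiniteDimensional K Γ]
    {f : RegularDual K Γ →ₗ[Γ] Γ} (hf : f ≠ 0) (M : ModuleCat.{u} Λ) (n : ℕ)
    (h : Subsingleton (Ext.{u} ((coextend K Λ Γ).obj M)
      (ModuleCat.of (Λ ⊗[K] Γ) (Λ ⊗[K] Γ)) n)) :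
    Subsingleton (Ext.{u} M (ModuleCat.of Λ Λ) n) := by
  obtain ⟨x, hx⟩ : ∃ x, f x ≠ 0 := by
    by_contra! hx
    exact hf (LinearMap.ext hx)
  obtain ⟨φ, hφ⟩ := Module.Projective.exists_dual_eq_one K hx
  let η : 𝟭 (ModuleCat.{u} Λ) ⟶ coextend K Λ Γ ⋙ restrict K Λ Γ :=
    TensorAlgebra.unit (show Γ →ₗ[K] K from x)
  let ψ : (coextend K Λ Γ).obj (ModuleCat.of Λ Λ) ⟶ ModuleCat.of (Λ ⊗[K] Γ) (Λ ⊗[K] Γ) :=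
    ModuleCat.ofHom (contract f)
  let ρ : (restrict K Λ Γ).obj (ModuleCat.of (Λ ⊗[K] Γ) (Λ ⊗[K] Γ)) ⟶ ModuleCat.of Λ Λ :=
    ModuleCat.ofHom (X := (restrict K Λ Γ).obj (ModuleCat.of (Λ ⊗[K] Γ) (Λ ⊗[K] Γ)))
      (slice φ ∘ₗ (restrictEquiv K Λ Γ).symm.toLinearMap)
  -- The composite is l ↦ l ⊗ x ↦ l ⊗ f x ↦ φ (f x) • l = l.
  have hid : η.app (ModuleCat.of Λ Λ) ≫ (restrict K Λ Γ).map ψ ≫ ρ = 𝟙 _ := by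
    refine ModuleCat.hom_ext (LinearMap.ext fun l => ?_)
    refine (congrArg (slice φ) (contract_unit (Λ := Λ) f x l)).trans ?_
    exact (slice_tmul φ (show Λ from l) (f x)).trans (by rw [hφ, one_smul]; rfl)
  refine subsingleton_of_forall_eq 0 fun e => ?_
  have hψ : (e.mapExactFunctor (coextend K Λ Γ)).comp (Ext.mk₀ ψ) (add_zero n) = 0 :=
    Subsingleton.elim _ _
  have hψ' := congrArg (Ext.mapExactFunctor (restrict K Λ Γ)) hψ
  rw [Ext.mapExactFunctor_comp, Ext.mapExactFunctor_mk₀, Ext.mapExactFunctor_zero] at hψ'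
  let e' := (e.mapExactFunctor (coextend K Λ Γ)).mapExactFunctor (restrict K Λ Γ)
  -- Insert the identity of Λ after e, move η across e by naturality, and meet the restriction of
  -- the vanishing class `hψ`.
  calc e = (e.comp (Ext.mk₀ (η.app _)) (add_zero n)).comp
        (Ext.mk₀ ((restrict K Λ Γ).map ψ ≫ ρ)) (add_zero n) := by
        rw [Ext.comp_assoc_of_third_deg_zero, Ext.mk₀_comp_mk₀, hid]
        exact (Ext.comp_mk₀_id e).symm
    _ = ((Ext.mk₀ (η.app M)).comp e' (zero_add n)).comp
        (Ext.mk₀ ((restrict K Λ Γ).map ψ ≫ ρ)) (add_zero n) := by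
        rw [← Ext.mapExactFunctor_naturality (coextend K Λ Γ) (restrict K Λ Γ) η e]
    _ = (Ext.mk₀ (η.app M)).comp ((e'.comp (Ext.mk₀ ((restrict K Λ Γ).map ψ)) (add_zero n)).comp
        (Ext.mk₀ ρ) (add_zero n)) (zero_add n) := by
        rw [Ext.comp_assoc_of_third_deg_zero, Ext.comp_assoc_of_third_deg_zero, Ext.mk₀_comp_mk₀]
    _ = 0 := by rw [hψ', Ext.zero_comp, Ext.comp_zero]

theorem proposition5p1 (K Λ Γ : Type u) [Field K]
    [Ring Λ] [Algebra K Λ] [FiniteDimensional K Λ]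
    [Ring Γ] [Algebra K Γ] [FiniteDimensional K Γ]
    (n : ℕ) (hn : 1 ≤ n)
    (hΛ : injectiveDimension (ModuleCat.of Λ Λ) = (n : WithBot ℕ∞))
    (hC : ∃ j : ℕ, n ≤ j ∧ ∃ 𝒞 : ObjectProperty (ModuleCat.{u} (Λ ⊗[K] Γ)),
      IsMaximalOrthogonal j 𝒞 (ModuleCat.isFG (Λ ⊗[K] Γ))) :
    ∀ f : RegularDual K Γ →ₗ[Γ] Γ, f = 0 := by
  intro f
  by_contra hf
  obtain ⟨j, hj, 𝒞, h𝒞⟩ := hC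
  obtain ⟨m, rfl⟩ := Nat.exists_eq_add_of_le' hn
  -- With n = m + 1, dimension at most n reads as less than m + 2; the contradiction will be
  -- dimension less than m + 1.
  have hlt : HasInjectiveDimensionLT (ModuleCat.of Λ Λ) (m + 2) :=
    (injectiveDimension_le_iff _ _).mp hΛ.le
  refine (injectiveDimension_ge_iff _ _).mp hΛ.ge ?_
  refine hasInjectiveDimensionLT_of_subsingleton_ext_regularDual K Λ m _
    (TensorAlgebra.subsingleton_ext_of_coextend hf _ _ (h𝒞.subsingleton_ext ?_ ?_ hn hj))
  · have : IsNoetherianRing Λ := isNoetherian_of_tower K inferInstance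
    have : Injective (ModuleCat.of Λ (RegularDual K Λ)) :=
      (Module.injective_iff_injective_object _ _).mp (RegularDual.injective K Λ)
    -- Coextension preserves injectives, being right adjoint to the exact functor of restriction.
    have := Injective.injective_of_adjoint
      (ModuleCat.restrictCoextendScalarsAdj.{u} (TensorAlgebra.incl K Λ Γ))
      (ModuleCat.of Λ (RegularDual K Λ))
    exact h𝒞.of_injective _ (TensorAlgebra.isFG_coextend _)
  · have : Projective (ModuleCat.of (Λ ⊗[K] Γ) (Λ ⊗[K] Γ)) :=
      (IsProjective.iff_projective _).mp inferInstance
    exact h𝒞.of_projective _ (Module.Finite.self _)
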